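/- Let $\mathcal M_k(\mathbb R)$ be the set of real $k\times k$ matrices all of whose eigenvalues are real, and let $\|\cdot\|$ be a matrix norm on the real $k\times k$ matrices (a norm with $\|XY\|\le\|X\|\,\|Y\|$). Let $m\ge 1$ and $\ell\ge 0$ be integers, and let $f\in C^{2m-2+\ell}([-1,1])$ be a real function such that $f^{(2m-2+\ell)}$ is absolutely continuous on $[-1,1]$ and $f^{(2m-1+\ell)}$ (which exists almost everywhere) coincides almost everywhere with a function of bounded variation on $[-1,1]$; derivatives at $\pm1$ are one-sided. For a Jordan form $A=Z^{-1}JZ$, $J=\operatorname{diag}(J_1,\dots,J_p)$, where $J_i$ is the upper triangular Jordan block of order $k_i$ with eigenvalue $\lambda_i\in[-1,1]$, put $f(A)=Z^{-1}\operatorname{diag}(f(J_1),\dots,f(J_p))Z$, where $f(J_i)$ is the upper triangular $k_i\times k_i$ matrix with entries $f^{(s-r)}(\lambda_i)/(s-r)!$ for $r\le s$. Let $T_n$ be the Chebyshev polynomials of the first kind, $\alpha_n[f]=\frac2\pi\int_{-1}^1\frac{f(t)T_n(t)}{\sqrt{1-t^2}}\,dt$, and $$\mathcal S_N(f)(A)=\tfrac12\alpha_0[f]\,I+\sum_{n=1}^N\alpha_n[f]\,T_n(A).$$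 Then there is a constant $K$, depending only on $f,\ell,m$ and the norm $\|\cdot\|$ (in particular on $k$ through the norm), such that for every $A\in\mathcal M_k(\mathbb R)$ with spectral radius $\rho(A)\le 1$ whose largest Jordan block has size $m$, every Jordan form $A=Z^{-1}JZ$, and every integer $N>2m-1+\ell$, $$\|\mathcal S_N(f)(A)-f(A)\|\le \frac{C}{\bigl(N-(2m-1+\ell)\bigr)^{\ell+1}},\qquad C=K\,\|Z^{-1}\|_1\,\|Z\|_1 ,$$ where $\|X\|_1=\max_i\sum_j|X_{ij}|$. In particular $C$ is independent of $N$, and it depends on $A$ only through $m$ and the condition number of the Jordan basis. -/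

import Mathlib

open Set MeasureTheory Polynomial
open scoped NNReal Nat

noncomputable section

/-- The `n`-th Chebyshev coefficient
`α_n[f] = (2 / π) ∫_{-1}^{1} f(t) T_n(t) / √(1 - t²) dt`. -/
def chebyshevCoeff (f : ℝ → ℝ) (n : ℕ) : ℝ :=
  2 / Real.pi *
    ∫ t in (-1 : ℝ)..1, f t * (Polynomial.Chebyshev.T ℝ (n : ℤ)).eval t / √(1 - t ^ 2)

/-- The truncated matrix Chebyshev expansion `∑' n ≤ N, α_n[f] T_n(A)`, where the dash means that
the term `n = 0` is halved. -/
def chebyshevPartialSum {k : ℕ} (f : ℝ → ℝ) (N : ℕ) (A : Matrix (Fin k) (Fin k) ℝ) :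
    Matrix (Fin k) (Fin k) ℝ :=
  ∑ n ∈ Finset.range (N + 1),
    ((if n = 0 then 1 / 2 else 1) * chebyshevCoeff f n) •
      Polynomial.aeval A (Polynomial.Chebyshev.T ℝ (n : ℤ))

/-- The Jordan block of order `n` with eigenvalue `lam`: `lam` on the diagonal and `1` on the first
superdiagonal. -/
def jordanBlock (n : ℕ) (lam : ℝ) : Matrix (Fin n) (Fin n) ℝ :=
  Matrix.of fun i j => if i = j then lam else if (i : ℕ) + 1 = (j : ℕ) then 1 else 0

/-- The value of `f` at the Jordan block of order `n` with eigenvalue `lam`: the upper triangular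
matrix whose `(i, j)` entry is `f^{(j - i)}(lam) / (j - i)!` for `i ≤ j`. Derivatives are taken
within `[-1, 1]`, hence are one-sided at `± 1`. -/
def jordanBlockFun (f : ℝ → ℝ) (n : ℕ) (lam : ℝ) : Matrix (Fin n) (Fin n) ℝ :=
  Matrix.of fun i j =>
    if i ≤ j then
      iteratedDerivWithin ((j : ℕ) - (i : ℕ)) f (Icc (-1) 1) lam / (((j : ℕ) - (i : ℕ))! : ℝ)
    else 0

/-- The `k × k` block diagonal matrix with the given consecutive diagonal blocks. -/
def blockDiag {k p : ℕ} (size : Fin p → ℕ) (h : ∑ i, size i = k)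
    (M : ∀ i, Matrix (Fin (size i)) (Fin (size i)) ℝ) : Matrix (Fin k) (Fin k) ℝ :=
  Matrix.reindex (finSigmaFinEquiv.trans (finCongr h)) (finSigmaFinEquiv.trans (finCongr h))
    (Matrix.blockDiagonal' M)

/-- A real Jordan form `A = Z⁻¹ J Z` of the matrix `A`, with `J` block diagonal with Jordan
blocks. A real matrix has one exactly when all its complex eigenvalues are real. -/
structure JordanForm {k : ℕ} (A : Matrix (Fin k) (Fin k) ℝ) where
  /-- number of Jordan blocks -/
  numBlocks : ℕ
  /-- orders of the blocks -/
  size : Fin numBlocks → ℕ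
  size_pos : ∀ i, 0 < size i
  sum_size : ∑ i, size i = k
  /-- eigenvalues of the blocks -/
  eigenvalue : Fin numBlocks → ℝ
  /-- the (invertible) change of basis -/
  Z : (Matrix (Fin k) (Fin k) ℝ)ˣ
  eq_conj : A = (↑Z⁻¹ : Matrix (Fin k) (Fin k) ℝ) *
    blockDiag size sum_size (fun i => jordanBlock (size i) (eigenvalue i)) *
      (↑Z : Matrix (Fin k) (Fin k) ℝ)

/-- The norm `max_i ∑_j |X i j|`. -/
def rowSumNorm {k : ℕ} (X : Matrix (Fin k) (Fin k) ℝ) : ℝ :=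
  ((Finset.univ.sup fun i => ∑ j, ‖X i j‖₊ : ℝ≥0) : ℝ)

namespace JordanForm

variable {k : ℕ} {A : Matrix (Fin k) (Fin k) ℝ}

/-- The order of the largest Jordan block. -/
def maxBlockSize (D : JordanForm A) : ℕ := Finset.univ.sup D.size

/-- The matrix function `f(A) = Z⁻¹ diag(f(J_1), …, f(J_p)) Z`. -/
def matrixFunction (D : JordanForm A) (f : ℝ → ℝ) : Matrix (Fin k) (Fin k) ℝ :=
  (↑D.Z⁻¹ : Matrix (Fin k) (Fin k) ℝ) *
    blockDiag D.size D.sum_size (fun i => jordanBlockFun f (D.size i) (D.eigenvalue i)) *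
      (↑D.Z : Matrix (Fin k) (Fin k) ℝ)

/-- The condition number `‖Z⁻¹‖ ‖Z‖` of the Jordan basis, in the maximal row sum norm. -/
def condNumber (D : JordanForm A) : ℝ :=
  rowSumNorm (↑D.Z⁻¹ : Matrix (Fin k) (Fin k) ℝ) * rowSumNorm (↑D.Z : Matrix (Fin k) (Fin k) ℝ)

end JordanForm

/-- The derivative of `h` on `[-1, 1]`, which need only exist almost everywhere, is of bounded
variation: it agrees almost everywhere with a function of bounded variation on `[-1, 1]`. -/
def HasBoundedVariationDeriv (h : ℝ → ℝ) : Prop :=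
  ∃ g : ℝ → ℝ, BoundedVariationOn g (Icc (-1) 1) ∧
    ∀ᵐ x ∂(volume.restrict (Icc (-1 : ℝ) 1)), HasDerivWithinAt h (g x) (Icc (-1) 1) x

end

/-! Write `M = m - 1` and `q = 2 * M + ℓ`. The entries of `P(J) - f(J)` for a Jordan block `J` are
`(P - f)^{(d)}(λ) / d!` with `d ≤ M`. It is therefore enough to bound, uniformly on `[-1, 1]`, the
error of the partial sums after `s ≤ M` termwise differentiations; conjugation by `Z` then costs the
condition number, and comparing norms costs a constant.

Two estimates give this scalar bound. With `t = cos θ` the coefficients become cosine moments. A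
function of bounded variation has moments `O(1/n)`, and each integration by parts gains one power of
`n`, so `α_n[f] = O(n^{-(q+2)})` (`exists_cosMoment_le_of_contDiffOn`). Moreover `|T_n^{(s)}|` is at
most `T_n^{(s)}(1) ≤ n^{2s}` on `[-1, 1]`. The differentiated series thus has terms `O(n^{-(ℓ+2)})`:
it converges to the derivative of `f`, with tail `O(N^{-(ℓ+1)})`
(`exists_abs_chebyshev_sub_iteratedDerivWithin_le`). -/

/-! ### Cosine moments and bounded variation -/

/-- The cosine moment `∫_0^π g(cos θ) cos(n θ) dθ`. -/
noncomputable def cosMoment (g : ℝ → ℝ) (n : ℕ) : ℝ :=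
  ∫ θ in (0 : ℝ)..Real.pi, g (Real.cos θ) * Real.cos (n * θ)

theorem chebyshevCoeff_eq_cosMoment (f : ℝ → ℝ) (n : ℕ) :
    chebyshevCoeff f n = 2 / Real.pi * cosMoment f n := by
  have h := Polynomial.Chebyshev.integral_measureT_eq_integral_cos
    (f := fun t => f t * (Polynomial.Chebyshev.T ℝ (n : ℤ)).eval t)
  rw [Polynomial.Chebyshev.integral_measureT] at h
  simp only [Polynomial.Chebyshev.T_real_cos, Int.cast_natCast] at h
  rw [chebyshevCoeff, cosMoment, ← h]
  simp only [div_eq_mul_inv, Real.sqrt_inv]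

theorem BoundedVariationOn.intervalIntegrable {g : ℝ → ℝ} {a b : ℝ}
    (hg : BoundedVariationOn g (uIcc a b)) : IntervalIntegrable g volume a b := by
  obtain ⟨p, q, hp, hq, rfl⟩ :=
    hg.locallyBoundedVariationOn.exists_monotoneOn_sub_monotoneOn
  exact hp.intervalIntegrable.sub hq.intervalIntegrable

theorem BoundedVariationOn.countable_not_continuousWithinAt {g : ℝ → ℝ} {s : Set ℝ}
    (hg : BoundedVariationOn g s) : {x ∈ s | ¬ ContinuousWithinAt g s x}.Countable := by
  obtain ⟨p, q, hp, hq, rfl⟩ :=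
    hg.locallyBoundedVariationOn.exists_monotoneOn_sub_monotoneOn
  refine (hp.countable_not_continuousWithinAt.union
    hq.countable_not_continuousWithinAt).mono ?_
  rintro x ⟨hx, hc⟩
  by_contra h
  simp only [mem_union, mem_ofPred_eq, not_or, not_and, not_not] at h
  exact hc ((h.1 hx).sub (h.2 hx))

theorem BoundedVariationOn.comp_cos {g : ℝ → ℝ} (hg : BoundedVariationOn g (Icc (-1) 1)) :
    BoundedVariationOn (fun θ => g (Real.cos θ)) (Icc 0 Real.pi) :=
  ne_top_of_le_ne_top hg (eVariationOn.comp_le_of_antitoneOn g Real.cos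
    Real.strictAntiOn_cos.antitoneOn fun θ _ => Real.cos_mem_Icc θ)

theorem integral_cos_half_period {n : ℕ} (hn : n ≠ 0) (i : ℕ) :
    ∫ θ in (i * (Real.pi / n))..((i + 1 : ℕ) * (Real.pi / n)), Real.cos (n * θ) = 0 := by
  have hn' : (n : ℝ) ≠ 0 := by exact_mod_cast hn
  rw [intervalIntegral.integral_comp_mul_left _ hn', integral_cos]
  have h (j : ℕ) : Real.sin (n * (j * (Real.pi / n))) = 0 := by
    rw [show (n : ℝ) * (j * (Real.pi / n)) = j * Real.pi by field_simp]
    exact Real.sin_nat_mul_pi j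
  rw [h, h]
  simp

/-- The cosine coefficients of a function of bounded variation are `O(1 / n)`. -/
theorem BoundedVariationOn.abs_integral_mul_cos_le {h : ℝ → ℝ}
    (hh : BoundedVariationOn h (Icc 0 Real.pi)) {n : ℕ} (hn : n ≠ 0) :
    |∫ θ in (0 : ℝ)..Real.pi, h θ * Real.cos (n * θ)| ≤
      (eVariationOn h (Icc 0 Real.pi)).toReal * Real.pi / n := by
  have hn' : (0 : ℝ) < n := by positivity
  -- The nodes cut `[0, π]` into `n` half-periods of `cos (n θ)`, on each of which its integral
  -- vanishes.
  set u : ℕ → ℝ := fun i => i * (Real.pi / n) with hu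
  have hmono : Monotone u := fun i j hij => by
    simp only [hu]; gcongr
  have hu0 : u 0 = 0 := by simp [hu]
  have hun : u n = Real.pi := by simp only [hu]; field_simp
  have hsub {i : ℕ} (hi : i < n) : Icc (u i) (u (i + 1)) ⊆ Icc 0 Real.pi := by
    rw [← hu0, ← hun]
    exact Icc_subset_Icc (hmono (Nat.zero_le i)) (hmono hi)
  have hint {i : ℕ} (hi : i < n) : IntervalIntegrable h volume (u i) (u (i + 1)) := by
    apply BoundedVariationOn.intervalIntegrable
    rw [uIcc_of_le (hmono i.le_succ)]
    exact hh.mono (hsub hi)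
  have hcos : Continuous fun θ : ℝ => Real.cos (n * θ) := by fun_prop
  have hpiece {i : ℕ} (hi : i < n) :
      |∫ θ in (u i)..(u (i + 1)), h θ * Real.cos (n * θ)| ≤
        (eVariationOn h (Icc (u i) (u (i + 1)))).toReal * (Real.pi / n) := by
    -- Subtracting the constant `h (u i)` is free, and leaves a factor bounded by the variation of
    -- `h` on the piece. Variations of adjacent pieces add up.
    have h1 : ∫ θ in (u i)..(u (i + 1)), h θ * Real.cos (n * θ) =
        ∫ θ in (u i)..(u (i + 1)), (h θ - h (u i)) * Real.cos (n * θ) := by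
      simp only [sub_mul]
      rw [intervalIntegral.integral_sub ((hint hi).mul_continuousOn hcos.continuousOn)
        ((hcos.intervalIntegrable _ _).const_mul _), intervalIntegral.integral_const_mul,
        integral_cos_half_period hn]
      simp
    have h2 : |u (i + 1) - u i| = Real.pi / n := by
      have : u (i + 1) - u i = Real.pi / n := by simp only [hu]; push_cast; ring
      rw [this]; exact abs_of_nonneg (by positivity)
    rw [h1, ← h2, ← Real.norm_eq_abs]
    apply intervalIntegral.norm_integral_le_of_norm_le_const
    intro θ hθ
    rw [uIoc_of_le (hmono i.le_succ)] at hθ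
    have h3 := (hh.mono (hsub hi)).dist_le (Ioc_subset_Icc_self hθ)
      (left_mem_Icc.2 (hmono i.le_succ))
    rw [Real.dist_eq] at h3
    rw [norm_mul, Real.norm_eq_abs, Real.norm_eq_abs]
    calc _ ≤ (eVariationOn h (Icc (u i) (u (i + 1)))).toReal * 1 :=
          mul_le_mul h3 (Real.abs_cos_le_one _) (abs_nonneg _) ENNReal.toReal_nonneg
      _ = _ := mul_one _
  have hsum := intervalIntegral.sum_integral_adjacent_intervals (a := u) (n := n)
    (f := fun θ => h θ * Real.cos (n * θ)) (μ := volume)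
    fun i hi => (hint hi).mul_continuousOn hcos.continuousOn
  rw [hu0, hun] at hsum
  rw [← hsum]
  refine (Finset.abs_sum_le_sum_abs _ _).trans
    ((Finset.sum_le_sum fun i hi => hpiece (Finset.mem_range.1 hi)).trans_eq ?_)
  rw [← Finset.sum_mul, ← ENNReal.toReal_sum fun i hi => hh.mono (hsub (Finset.mem_range.1 hi)),
    eVariationOn.sum' h hmono, hu0, hun, mul_div_assoc]

/-! ### Decay of the moments under integration by parts -/

theorem exists_decay_of_succ {a : ℕ → ℝ} {p : ℕ} {C : ℝ}
    (h : ∀ n, |a (n + 1)| ≤ C / ((n : ℝ) + 1) ^ p) :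
    ∃ C', ∀ n, |a n| ≤ C' / ((n : ℝ) + 1) ^ p := by
  have hC : 0 ≤ C := by simpa using (abs_nonneg _).trans (h 0)
  -- `|a 0|` covers the index not controlled by the hypothesis; `2 ^ p` comes from `n + 2 ≤ 2 (n +
  -- 1)`.
  refine ⟨|a 0| + C * 2 ^ p, fun n => ?_⟩
  rcases n with _ | n
  · simp; positivity
  · refine (h n).trans ?_
    rw [div_le_div_iff₀ (by positivity) (by positivity)]
    push_cast
    have h1 : ((n : ℝ) + 1 + 1) ^ p ≤ 2 ^ p * ((n : ℝ) + 1) ^ p := by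
      rw [← mul_pow]; gcongr; linarith [(Nat.cast_nonneg n : (0 : ℝ) ≤ n)]
    calc C * ((n : ℝ) + 1 + 1) ^ p ≤ C * (2 ^ p * ((n : ℝ) + 1) ^ p) := by gcongr
      _ = C * 2 ^ p * ((n : ℝ) + 1) ^ p := by ring
      _ ≤ _ := by gcongr; linarith [abs_nonneg (a 0)]

theorem BoundedVariationOn.exists_cosMoment_le {g : ℝ → ℝ}
    (hg : BoundedVariationOn g (Icc (-1) 1)) :
    ∃ C, ∀ n : ℕ, |cosMoment g n| ≤ C / ((n : ℝ) + 1) ^ 1 := by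
  refine exists_decay_of_succ
    (C := (eVariationOn (fun θ => g (Real.cos θ)) (Icc 0 Real.pi)).toReal * Real.pi) fun n => ?_
  have h := hg.comp_cos.abs_integral_mul_cos_le n.succ_ne_zero
  rw [pow_one]
  simpa only [cosMoment, Nat.succ_eq_add_one, Nat.cast_add, Nat.cast_one] using h

/-- Integrate the derivative of `F(cos θ) sin((n+1)θ)`: the boundary terms vanish, and `sin θ
sin((n+1)θ)` is half the difference of two cosines. The fundamental theorem of calculus tolerates a
countable exceptional set. -/
theorem cosMoment_succ_eq_of_hasDerivAt {F g : ℝ → ℝ} {S : Set ℝ} (hS : S.Countable)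
    (hF : ContinuousOn F (Icc (-1) 1)) (hd : ∀ x ∈ Ioo (-1 : ℝ) 1 \ S, HasDerivAt F (g x) x)
    (hg : IntervalIntegrable (fun θ => g (Real.cos θ)) volume 0 Real.pi) (n : ℕ) :
    ((n : ℝ) + 1) * cosMoment F (n + 1) = (cosMoment g n - cosMoment g (n + 2)) / 2 := by
  have hpi := Real.pi_pos.le
  have hFc : ContinuousOn (fun θ => F (Real.cos θ)) (Icc 0 Real.pi) :=
    hF.comp Real.continuous_cos.continuousOn fun θ _ => Real.cos_mem_Icc θ
  have hT : (Icc 0 Real.pi ∩ Real.cos ⁻¹' S).Countable :=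
    Set.MapsTo.countable_of_injOn (f := Real.cos) (t := S) (fun θ h => h.2)
      (Real.injOn_cos.mono inter_subset_left) hS
  have hi1 : IntervalIntegrable (fun θ => ((n : ℝ) + 1) *
      (F (Real.cos θ) * Real.cos ((n + 1 : ℕ) * θ))) volume 0 Real.pi := by
    apply ContinuousOn.intervalIntegrable
    rw [uIcc_of_le hpi]
    exact continuousOn_const.mul (hFc.mul (by fun_prop))
  have hi2 (k : ℕ) : IntervalIntegrable (fun θ => g (Real.cos θ) * Real.cos (k * θ))
      volume 0 Real.pi :=
    hg.mul_continuousOn (by fun_prop)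
  have key := integral_eq_of_hasDerivAt_off_countable_of_le
    (fun θ => F (Real.cos θ) * Real.sin ((n + 1 : ℕ) * θ))
    (fun θ => ((n : ℝ) + 1) * (F (Real.cos θ) * Real.cos ((n + 1 : ℕ) * θ)) -
      2⁻¹ * (g (Real.cos θ) * Real.cos (n * θ) - g (Real.cos θ) * Real.cos ((n + 2 : ℕ) * θ)))
    hpi hT (hFc.mul (by fun_prop)) ?_ (hi1.sub (((hi2 _).sub (hi2 _)).const_mul _))
  · rw [intervalIntegral.integral_sub hi1 (((hi2 _).sub (hi2 _)).const_mul _),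
      intervalIntegral.integral_const_mul, intervalIntegral.integral_const_mul,
      intervalIntegral.integral_sub (hi2 _) (hi2 _), Real.sin_nat_mul_pi] at key
    simp only [mul_zero, Real.sin_zero, sub_zero] at key
    simp only [cosMoment]
    linarith
  · rintro θ ⟨hθ, hθS⟩
    have hmem : Real.cos θ ∈ Ioo (-1 : ℝ) 1 \ S := by
      refine ⟨⟨?_, ?_⟩, fun h => hθS ⟨Ioo_subset_Icc_self hθ, h⟩⟩
      · rw [← Real.cos_pi]
        exact Real.strictAntiOn_cos (Ioo_subset_Icc_self hθ) (right_mem_Icc.2 hpi) hθ.2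
      · rw [← Real.cos_zero]
        exact Real.strictAntiOn_cos (left_mem_Icc.2 hpi) (Ioo_subset_Icc_self hθ) hθ.1
    have h1 := (hd _ hmem).comp θ (Real.hasDerivAt_cos θ)
    have h2 : HasDerivAt (fun θ : ℝ => Real.sin ((n + 1 : ℕ) * θ))
        (Real.cos ((n + 1 : ℕ) * θ) * ((n + 1 : ℕ) * 1)) θ :=
      (Real.hasDerivAt_sin _).comp θ ((hasDerivAt_id θ).const_mul _)
    refine (h1.mul h2).congr_deriv ?_
    have e1 : ((n : ℕ) : ℝ) * θ = (n + 1 : ℕ) * θ - θ := by push_cast; ring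
    have e2 : ((n + 2 : ℕ) : ℝ) * θ = (n + 1 : ℕ) * θ + θ := by push_cast; ring
    rw [e1, e2, Real.cos_add, Real.cos_sub]
    simp only [Function.comp_apply, Nat.cast_add, Nat.cast_one]
    ring

theorem exists_cosMoment_le_of_hasDerivAt {F g : ℝ → ℝ} {S : Set ℝ} (hS : S.Countable)
    (hF : ContinuousOn F (Icc (-1) 1)) (hd : ∀ x ∈ Ioo (-1 : ℝ) 1 \ S, HasDerivAt F (g x) x)
    (hg : IntervalIntegrable (fun θ => g (Real.cos θ)) volume 0 Real.pi) {p : ℕ}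
    (hdecay : ∃ C, ∀ n : ℕ, |cosMoment g n| ≤ C / ((n : ℝ) + 1) ^ p) :
    ∃ C, ∀ n : ℕ, |cosMoment F n| ≤ C / ((n : ℝ) + 1) ^ (p + 1) := by
  obtain ⟨C, hC⟩ := hdecay
  have hC0 : 0 ≤ C := by simpa using (abs_nonneg _).trans (hC 0)
  refine exists_decay_of_succ (C := C) fun n => ?_
  have h1 := cosMoment_succ_eq_of_hasDerivAt hS hF hd hg n
  have h2 : |cosMoment g (n + 2)| ≤ C / ((n : ℝ) + 1) ^ p := by
    refine (hC _).trans ?_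
    gcongr
    linarith
  have h3 : ((n : ℝ) + 1) * |cosMoment F (n + 1)| ≤ C / ((n : ℝ) + 1) ^ p := by
    rw [← abs_of_nonneg (by positivity : (0 : ℝ) ≤ (n : ℝ) + 1), ← abs_mul,
      h1, abs_of_nonneg (by positivity : (0 : ℝ) ≤ (n : ℝ) + 1), abs_div, abs_two]
    have := abs_sub (cosMoment g n) (cosMoment g (n + 2))
    linarith [hC n]
  rw [pow_succ, ← div_div, le_div_iff₀ (by positivity)]
  linarith

/-- Upgrades "almost everywhere" to "off a countable set", as the integration by parts requires.
Absolute continuity makes `F` a primitive of `g`, so `F' = g` wherever `g` is continuous, and `g`,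
being a difference of monotone functions, has countably many discontinuities. -/
theorem AbsolutelyContinuousOnInterval.exists_countable_hasDerivAt {F g : ℝ → ℝ} {a b : ℝ}
    (hab : a ≤ b) (hF : AbsolutelyContinuousOnInterval F a b)
    (hg : BoundedVariationOn g (Icc a b))
    (hd : ∀ᵐ x ∂(volume.restrict (Icc a b)), HasDerivWithinAt F (g x) (Icc a b) x) :
    ∃ S : Set ℝ, S.Countable ∧ ∀ x ∈ Ioo a b \ S, HasDerivAt F (g x) x := by
  refine ⟨_, hg.countable_not_continuousWithinAt, fun x ⟨hx, hxS⟩ => ?_⟩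
  have hgc : ContinuousAt g x := by
    by_contra h
    exact hxS ⟨Ioo_subset_Icc_self hx,
      fun h' => h (h'.continuousAt (Icc_mem_nhds hx.1 hx.2))⟩
  have hgi : IntervalIntegrable g volume a b :=
    BoundedVariationOn.intervalIntegrable (by rwa [uIcc_of_le hab])
  rw [ae_restrict_iff' measurableSet_Icc] at hd
  have hae : ∀ᵐ t : ℝ, t ∈ Ioc a b → deriv F t = g t := by
    have hb : ∀ᵐ t : ℝ, t ≠ b := by simp [ae_iff]
    filter_upwards [hd, hb] with t ht htb htm
    exact ((ht (Ioc_subset_Icc_self htm)).hasDerivAt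
      (Icc_mem_nhds htm.1 (lt_of_le_of_ne htm.2 htb))).deriv
  have hFeq : ∀ y ∈ Ioo a b, F y = F a + ∫ t in a..y, g t := by
    intro y hy
    have h1 := (hF.mono (c := a) (d := y) (by
      rw [uIcc_of_le hab, uIcc_of_le hy.1.le]
      exact Icc_subset_Icc_right hy.2.le)).integral_deriv_eq_sub
    rw [intervalIntegral.integral_congr_ae (g := g)] at h1
    · linarith
    · filter_upwards [hae] with t ht htm
      rw [uIoc_of_le hy.1.le] at htm
      exact ht ⟨htm.1, htm.2.trans hy.2.le⟩
  have hder : HasDerivAt (fun y => F a + ∫ t in a..y, g t) (g x) x := by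
    refine HasDerivAt.const_add _ (intervalIntegral.integral_hasDerivAt_right ?_ ?_ hgc)
    · exact hgi.mono_set (by
        rw [uIcc_of_le hab, uIcc_of_le hx.1.le]; exact Icc_subset_Icc_right hx.2.le)
    · exact ⟨Ioc a b, Ioc_mem_nhds hx.1 hx.2, hgi.1.aestronglyMeasurable⟩
  refine hder.congr_of_eventuallyEq ?_
  filter_upwards [Ioo_mem_nhds hx.1 hx.2] with y hy using hFeq y hy

theorem hasDerivAt_iteratedDerivWithin {f : ℝ → ℝ} {q j : ℕ} {a b x : ℝ}
    (hf : ContDiffOn ℝ (q : WithTop ℕ∞) f (Icc a b)) (hj : j < q) (hx : x ∈ Ioo a b) :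
    HasDerivAt (iteratedDerivWithin j f (Icc a b))
      (iteratedDerivWithin (j + 1) f (Icc a b) x) x := by
  have hab : a < b := hx.1.trans hx.2
  have h := hf.differentiableOn_iteratedDerivWithin (m := j) (by exact_mod_cast hj)
    (uniqueDiffOn_Icc hab) x (Ioo_subset_Icc_self hx)
  have h2 := h.hasDerivWithinAt.hasDerivAt (Icc_mem_nhds hx.1 hx.2)
  rwa [← iteratedDerivWithin_succ] at h2

theorem exists_cosMoment_le_of_contDiffOn {f : ℝ → ℝ} {q : ℕ}
    (hf : ContDiffOn ℝ (q : WithTop ℕ∞) f (Icc (-1) 1))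
    (hac : AbsolutelyContinuousOnInterval (iteratedDerivWithin q f (Icc (-1) 1)) (-1) 1)
    (hbv : HasBoundedVariationDeriv (iteratedDerivWithin q f (Icc (-1) 1))) :
    ∃ C, ∀ n : ℕ, |cosMoment f n| ≤ C / ((n : ℝ) + 1) ^ (q + 2) := by
  have hcont {j : ℕ} (hj : j ≤ q) : ContinuousOn (iteratedDerivWithin j f (Icc (-1) 1))
      (Icc (-1) 1) :=
    hf.continuousOn_iteratedDerivWithin (by exact_mod_cast hj) (uniqueDiffOn_Icc (by norm_num))
  have main : ∀ i j : ℕ, i + j = q → ∃ C, ∀ n : ℕ,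
      |cosMoment (iteratedDerivWithin j f (Icc (-1) 1)) n| ≤ C / ((n : ℝ) + 1) ^ (i + 2) := by
    intro i
    induction i with
    | zero =>
      intro j hj
      obtain rfl : j = q := by omega
      obtain ⟨g, hg, hd⟩ := hbv
      obtain ⟨S, hS, hdS⟩ := hac.exists_countable_hasDerivAt (by norm_num) hg hd
      refine exists_cosMoment_le_of_hasDerivAt hS (hcont le_rfl) hdS ?_ hg.exists_cosMoment_le
      apply BoundedVariationOn.intervalIntegrable
      rw [uIcc_of_le Real.pi_pos.le]
      exact hg.comp_cos
    | succ i ih =>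
      intro j hj
      refine exists_cosMoment_le_of_hasDerivAt countable_empty (hcont (by omega))
        (fun x hx => hasDerivAt_iteratedDerivWithin hf (by omega) hx.1) ?_
        (ih (j + 1) (by omega))
      exact ((hcont (j := j + 1) (by omega)).comp Real.continuous_cos.continuousOn
        fun θ _ => Real.cos_mem_Icc θ).intervalIntegrable
  simpa using main q 0 (by omega)

theorem integral_neg_pi_pi_eq (h : ℝ → ℂ) (hh : Continuous h) :
    ∫ θ in (-Real.pi)..Real.pi, h θ = ∫ θ in (0 : ℝ)..Real.pi, (h θ + h (-θ)) := by
  have hn : Continuous fun θ => h (-θ) := hh.comp continuous_neg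
  rw [intervalIntegral.integral_add (hh.intervalIntegrable _ _) (hn.intervalIntegrable _ _),
    intervalIntegral.integral_comp_neg, neg_zero, add_comm,
    intervalIntegral.integral_add_adjacent_intervals (hh.intervalIntegrable _ _)
      (hh.intervalIntegrable _ _)]

/-- A function which is continuous on `[-1, 1]` and has summable Chebyshev coefficients is the sum
of its Chebyshev series. -/
theorem hasSum_chebyshev_series {f : ℝ → ℝ} (hf : ContinuousOn f (Icc (-1) 1))
    (hs : Summable fun n => |cosMoment f n|) {x : ℝ} (hx : x ∈ Icc (-1 : ℝ) 1) :
    HasSum (fun n : ℕ => ((if n = 0 then 1 / 2 else 1) * chebyshevCoeff f n) *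
      (Polynomial.Chebyshev.T ℝ (n : ℤ)).eval x) (f x) := by
  have hpi := Real.pi_pos
  have : Fact (0 < 2 * Real.pi) := ⟨by positivity⟩
  have hfc : Continuous fun θ : ℝ => f (Real.cos θ) :=
    hf.comp_continuous Real.continuous_cos Real.cos_mem_Icc
  have hfC : Continuous fun θ : ℝ => (f (Real.cos θ) : ℂ) := Complex.continuous_ofReal.comp hfc
  have hper : Function.Periodic (fun θ : ℝ => (f (Real.cos θ) : ℂ)) (2 * Real.pi) :=
    fun θ => by simp
  let G : C(AddCircle (2 * Real.pi), ℂ) := ⟨hper.lift, continuous_coinduced_dom.mpr hfC⟩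
  have hG (θ : ℝ) : G (θ : AddCircle (2 * Real.pi)) = f (Real.cos θ) := hper.lift_coe θ
  have hexp (n : ℤ) (θ : ℝ) : fourier n (θ : AddCircle (2 * Real.pi)) =
      Complex.exp (n * θ * Complex.I) := by
    rw [fourier_coe_apply]
    congr 1
    have : (Real.pi : ℂ) ≠ 0 := by exact_mod_cast hpi.ne'
    push_cast
    field_simp
  have hcoeff (n : ℤ) : fourierCoeff G n = ((1 / Real.pi * cosMoment f n.natAbs : ℝ) : ℂ) := by
    rw [fourierCoeff_eq_intervalIntegral G n (-Real.pi),
      show -Real.pi + 2 * Real.pi = Real.pi by ring]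
    simp only [hG, hexp, smul_eq_mul]
    rw [integral_neg_pi_pi_eq _ (by fun_prop)]
    have : ∀ θ : ℝ, Complex.exp (((-n : ℤ) : ℂ) * θ * Complex.I) * (f (Real.cos θ) : ℂ) +
        Complex.exp (((-n : ℤ) : ℂ) * ((-θ : ℝ) : ℂ) * Complex.I) * (f (Real.cos (-θ)) : ℂ) =
        ((2 * (f (Real.cos θ) * Real.cos (n.natAbs * θ)) : ℝ) : ℂ) := by
      intro θ
      have h1 : Real.cos (n.natAbs * θ) = Real.cos (n * θ) := by
        rw [Nat.cast_natAbs, Int.cast_abs]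
        rcases abs_cases (n : ℝ) with ⟨h, _⟩ | ⟨h, _⟩ <;> rw [h]
        rw [neg_mul, Real.cos_neg]
      rw [h1, Real.cos_neg]
      push_cast
      rw [Complex.cos]
      ring_nf
    simp only [this]
    rw [intervalIntegral.integral_ofReal, intervalIntegral.integral_const_mul, cosMoment,
      Complex.real_smul, ← Complex.ofReal_mul]
    congr 1
    field_simp
  have hsum : Summable (fourierCoeff G) := by
    have h0 : Summable fun n : ℕ => ((1 / Real.pi * cosMoment f n : ℝ) : ℂ) := by
      rw [Complex.summable_ofReal]
      exact (Summable.of_abs hs).mul_left _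
    refine Summable.of_nat_of_neg ?_ ?_ <;> simpa [hcoeff] using h0
  have key := (has_pointwise_sum_fourier_series_of_summable hsum
    (Real.arccos x : AddCircle (2 * Real.pi))).nat_add_neg
  have hcx : Real.cos (Real.arccos x) = x := Real.cos_arccos hx.1 hx.2
  rw [hG, hcx] at key
  have hterm (n : ℕ) : fourierCoeff G (n : ℤ) •
        fourier (n : ℤ) (Real.arccos x : AddCircle (2 * Real.pi)) +
      fourierCoeff G (-(n : ℤ)) •
        fourier (-(n : ℤ)) (Real.arccos x : AddCircle (2 * Real.pi)) =
      ((chebyshevCoeff f n * (Polynomial.Chebyshev.T ℝ (n : ℤ)).eval x : ℝ) : ℂ) := by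
    have hT := Polynomial.Chebyshev.T_real_cos (Real.arccos x) (n : ℤ)
    rw [hcx] at hT
    rw [hexp, hexp, hcoeff, hcoeff, hT, chebyshevCoeff_eq_cosMoment]
    simp only [Int.natAbs_neg, Int.natAbs_natCast, smul_eq_mul]
    push_cast
    rw [Complex.cos]
    ring_nf
  have h0 : fourierCoeff G 0 • fourier 0 (Real.arccos x : AddCircle (2 * Real.pi)) =
      ((chebyshevCoeff f 0 / 2 : ℝ) : ℂ) := by
    rw [hexp, hcoeff, chebyshevCoeff_eq_cosMoment]
    simp
    ring
  simp only [hterm] at key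
  rw [h0, ← Complex.ofReal_add, Complex.hasSum_ofReal] at key
  have := key.sub (hasSum_ite_eq (0 : ℕ) (chebyshevCoeff f 0 / 2))
  rw [add_sub_cancel_right] at this
  refine Eq.mp (congrArg (HasSum · (f x)) (funext fun n => ?_)) this
  split_ifs with h
  · subst h; simp; ring
  · simp

theorem eval_one_iterate_derivative_chebyshev_T_le (n k : ℕ) :
    0 ≤ (derivative^[k] (Polynomial.Chebyshev.T ℝ (n : ℤ))).eval 1 ∧
    (derivative^[k] (Polynomial.Chebyshev.T ℝ (n : ℤ))).eval 1 ≤ (n : ℝ) ^ (2 * k) ∧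
    (n < k → (derivative^[k] (Polynomial.Chebyshev.T ℝ (n : ℤ))).eval 1 = 0) := by
  induction k with
  | zero => simp
  | succ k ih =>
    obtain ⟨h0, h1, h2⟩ := ih
    have h := Polynomial.Chebyshev.iterate_derivative_T_eval_one_recurrence (R := ℝ) (n : ℤ) k
    set D := (derivative^[k] (Polynomial.Chebyshev.T ℝ (n : ℤ))).eval 1
    set D' := (derivative^[k + 1] (Polynomial.Chebyshev.T ℝ (n : ℤ))).eval 1
    simp only [Int.cast_natCast] at h
    have hk : (0 : ℝ) ≤ k := Nat.cast_nonneg k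
    rcases lt_or_ge n k with hnk | hnk
    · rw [h2 hnk, mul_zero] at h
      have : D' = 0 := (mul_eq_zero.1 h).resolve_left (by positivity)
      rw [this]
      exact ⟨le_rfl, by positivity, fun _ => rfl⟩
    · have hnk' : (k : ℝ) ≤ n := by exact_mod_cast hnk
      have hf : 0 ≤ (n : ℝ) ^ 2 - (k : ℝ) ^ 2 := by nlinarith
      have hD' : 0 ≤ D' := by
        have : 0 ≤ (2 * (k : ℝ) + 1) * D' := h ▸ mul_nonneg hf h0
        exact nonneg_of_mul_nonneg_right this (by positivity)
      refine ⟨hD', ?_, fun hlt => ?_⟩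
      · calc D' ≤ (2 * (k : ℝ) + 1) * D' := by nlinarith
          _ = ((n : ℝ) ^ 2 - (k : ℝ) ^ 2) * D := h
          _ ≤ (n : ℝ) ^ 2 * (n : ℝ) ^ (2 * k) := by gcongr; nlinarith
          _ = _ := by ring
      · obtain rfl : n = k := by omega
        rw [sub_self, zero_mul] at h
        exact (mul_eq_zero.1 h).resolve_left (by positivity)

theorem abs_eval_iterate_derivative_chebyshev_T_le (n k : ℕ) {x : ℝ}
    (hx : x ∈ Icc (-1 : ℝ) 1) :
    |(derivative^[k] (Polynomial.Chebyshev.T ℝ (n : ℤ))).eval x| ≤ ((n : ℝ) + 1) ^ (2 * k) :=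
  (Polynomial.Chebyshev.abs_iterate_derivative_T_real_le _ _ (abs_le.2 hx)).trans <|
    (eval_one_iterate_derivative_chebyshev_T_le n k).2.1.trans (by gcongr; linarith)

/-- Termwise differentiation of a Chebyshev series. -/
theorem hasSum_iteratedDerivWithin_chebyshev {f : ℝ → ℝ} {a : ℕ → ℝ} {M : ℕ}
    (hf : ContDiffOn ℝ (M : WithTop ℕ∞) f (Icc (-1) 1))
    (ha : Summable fun n : ℕ => |a n| * ((n : ℝ) + 1) ^ (2 * M))
    (hsum : ∀ x ∈ Icc (-1 : ℝ) 1,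
      HasSum (fun n : ℕ => a n * (Polynomial.Chebyshev.T ℝ (n : ℤ)).eval x) (f x)) {s : ℕ}
    (hs : s ≤ M) : ∀ x ∈ Icc (-1 : ℝ) 1,
      HasSum (fun n : ℕ => a n * (derivative^[s] (Polynomial.Chebyshev.T ℝ (n : ℤ))).eval x)
        (iteratedDerivWithin s f (Icc (-1) 1) x) := by
  have hbound {k : ℕ} (hk : k ≤ M) (n : ℕ) {x : ℝ} (hx : x ∈ Icc (-1 : ℝ) 1) :
      ‖a n * (derivative^[k] (Polynomial.Chebyshev.T ℝ (n : ℤ))).eval x‖ ≤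
        |a n| * ((n : ℝ) + 1) ^ (2 * M) := by
    rw [norm_mul, Real.norm_eq_abs, Real.norm_eq_abs]
    gcongr
    refine (abs_eval_iterate_derivative_chebyshev_T_le n k hx).trans ?_
    gcongr
    linarith [(Nat.cast_nonneg n : (0 : ℝ) ≤ n)]
  induction s with
  | zero => simpa using hsum
  | succ s ih =>
    have ih := ih (by omega)
    have hEq : EqOn (fun x => ∑' n : ℕ, a n *
        (derivative^[s + 1] (Polynomial.Chebyshev.T ℝ (n : ℤ))).eval x)
        (iteratedDerivWithin (s + 1) f (Icc (-1) 1)) (Ioo (-1) 1) := by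
      intro x hx
      have h1 := hasDerivAt_tsum_of_isPreconnected ha isOpen_Ioo isPreconnected_Ioo
        (g := fun n x => a n * (derivative^[s] (Polynomial.Chebyshev.T ℝ (n : ℤ))).eval x)
        (g' := fun n x => a n * (derivative^[s + 1] (Polynomial.Chebyshev.T ℝ (n : ℤ))).eval x)
        (fun n y _ => by
          rw [Function.iterate_succ_apply']
          exact (Polynomial.hasDerivAt _ y).const_mul _)
        (fun n y hy => hbound hs n (Ioo_subset_Icc_self hy)) hx
        (ih x (Ioo_subset_Icc_self hx)).summable hx
      refine (h1.congr_of_eventuallyEq ?_).unique (hasDerivAt_iteratedDerivWithin hf hs hx)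
      filter_upwards [Ioo_mem_nhds hx.1 hx.2] with y hy
      exact (ih y (Ioo_subset_Icc_self hy)).tsum_eq.symm
    have hEq' := hEq.of_subset_closure
      (continuousOn_tsum (fun n => (by fun_prop)) ha fun n x hx => hbound hs n hx)
      (hf.continuousOn_iteratedDerivWithin (m := s + 1) (by exact_mod_cast hs)
        (uniqueDiffOn_Icc (by norm_num)))
      Ioo_subset_Icc_self (by rw [closure_Ioo (by norm_num)])
    intro x hx
    rw [← hEq' hx]
    exact (Summable.of_norm_bounded ha fun n => hbound hs n hx).hasSum

theorem inv_pow_succ_le_sub {x : ℝ} (hx : 0 < x) (p : ℕ) :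
    ((x + 1) ^ (p + 2))⁻¹ ≤ (x ^ (p + 1))⁻¹ - ((x + 1) ^ (p + 1))⁻¹ := by
  have h1 : x ^ p ≤ (x + 1) ^ p := by gcongr; linarith
  have h2 : 0 < x ^ p := by positivity
  have h3 : 0 < (x + 1) ^ p := by positivity
  rw [le_sub_iff_add_le, pow_succ _ (p + 1), pow_succ _ p, pow_succ x p,
    show ((x + 1) ^ p * (x + 1) * (x + 1))⁻¹ + ((x + 1) ^ p * (x + 1))⁻¹ =
      (x + 2) / ((x + 1) ^ p * (x + 1) * (x + 1)) by field_simp; ring, ← one_div,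
    div_le_div_iff₀ (by positivity) (by positivity)]
  nlinarith [mul_le_mul_of_nonneg_right h1 (by positivity : 0 ≤ x * (x + 2))]

theorem sum_range_inv_pow_le (N n p : ℕ) :
    ∑ i ∈ Finset.range n, (((i + (N + 1) : ℕ) : ℝ) + 1)⁻¹ ^ (p + 2) ≤
      (((N : ℝ) + 1) ^ (p + 1))⁻¹ := by
  have h : ∀ i ∈ Finset.range n, (((i + (N + 1) : ℕ) : ℝ) + 1)⁻¹ ^ (p + 2) ≤
      ((((i : ℕ) : ℝ) + N + 1) ^ (p + 1))⁻¹ - ((((i + 1 : ℕ) : ℝ) + N + 1) ^ (p + 1))⁻¹ := by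
    intro i _
    have := inv_pow_succ_le_sub (x := (i : ℝ) + N + 1) (by positivity) p
    rw [inv_pow, show ((i + (N + 1) : ℕ) : ℝ) + 1 = (i : ℝ) + N + 1 + 1 by push_cast; ring,
      show ((i + 1 : ℕ) : ℝ) + N + 1 = (i : ℝ) + N + 1 + 1 by push_cast; ring]
    exact this
  refine (Finset.sum_le_sum h).trans ?_
  rw [Finset.sum_range_sub' (fun i : ℕ => (((i : ℝ) + N + 1) ^ (p + 1))⁻¹)]
  simp only [Nat.cast_zero, zero_add, sub_le_self_iff]
  positivity

/-- The derivatives up to order `M` of the truncated Chebyshev series approximate those of `f`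
with an error `O(N^{-(ℓ + 1)})`, uniformly on `[-1, 1]`. -/
theorem exists_abs_chebyshev_sub_iteratedDerivWithin_le {f : ℝ → ℝ} {M ℓ : ℕ}
    (hf : ContDiffOn ℝ ((2 * M + ℓ : ℕ) : WithTop ℕ∞) f (Icc (-1) 1))
    (hac : AbsolutelyContinuousOnInterval
      (iteratedDerivWithin (2 * M + ℓ) f (Icc (-1) 1)) (-1) 1)
    (hbv : HasBoundedVariationDeriv (iteratedDerivWithin (2 * M + ℓ) f (Icc (-1) 1))) :
    ∃ C, ∀ s ≤ M, ∀ x ∈ Icc (-1 : ℝ) 1, ∀ N : ℕ,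
      |∑ n ∈ Finset.range (N + 1), ((if n = 0 then 1 / 2 else 1) * chebyshevCoeff f n) *
          (derivative^[s] (Polynomial.Chebyshev.T ℝ (n : ℤ))).eval x -
        iteratedDerivWithin s f (Icc (-1) 1) x| ≤ C / ((N : ℝ) + 1) ^ (ℓ + 1) := by
  obtain ⟨C, hC⟩ := exists_cosMoment_le_of_contDiffOn hf hac hbv
  have hC0 : 0 ≤ C := by simpa using (abs_nonneg _).trans (hC 0)
  set a : ℕ → ℝ := fun n => (if n = 0 then 1 / 2 else 1) * chebyshevCoeff f n with ha
  have hle (n : ℕ) : |a n| * ((n : ℝ) + 1) ^ (2 * M) ≤ C * ((n : ℝ) + 1)⁻¹ ^ (ℓ + 2) := by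
    have h1 : |a n| ≤ C / ((n : ℝ) + 1) ^ (2 * M + ℓ + 2) := by
      refine le_trans ?_ (hC n)
      rw [ha]
      simp only
      rw [chebyshevCoeff_eq_cosMoment, abs_mul, abs_mul,
        abs_of_nonneg (by positivity : 0 ≤ 2 / Real.pi), ← mul_assoc]
      refine mul_le_of_le_one_left (abs_nonneg _) (mul_le_one₀ ?_ (by positivity) ?_)
      · split_ifs <;> norm_num
      · rw [div_le_one Real.pi_pos]; exact Real.two_le_pi
    calc |a n| * ((n : ℝ) + 1) ^ (2 * M)
        ≤ C / ((n : ℝ) + 1) ^ (2 * M + ℓ + 2) * ((n : ℝ) + 1) ^ (2 * M) := by gcongr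
      _ = _ := by
        rw [add_assoc, pow_add, inv_pow]
        field_simp
  have hsum0 : Summable fun n : ℕ => C * ((n : ℝ) + 1)⁻¹ ^ (ℓ + 2) := by
    refine Summable.mul_left _ ?_
    have := (summable_nat_add_iff 1).2
      (Real.summable_nat_pow_inv (p := ℓ + 2).2 (by omega))
    simpa [inv_pow] using this
  have hsum1 : Summable fun n : ℕ => |a n| * ((n : ℝ) + 1) ^ (2 * M) :=
    hsum0.of_nonneg_of_le (fun n => by positivity) hle
  have hsum2 : Summable fun n => |cosMoment f n| := by
    refine hsum0.of_nonneg_of_le (fun n => abs_nonneg _) fun n => (hC n).trans ?_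
    rw [inv_pow, ← div_eq_mul_inv]
    gcongr
    · linarith [(Nat.cast_nonneg n : (0 : ℝ) ≤ n)]
    · omega
  have hser (s : ℕ) (hs : s ≤ M) := hasSum_iteratedDerivWithin_chebyshev (a := a)
    (hf.of_le (by exact_mod_cast (by omega : M ≤ 2 * M + ℓ))) hsum1
    (fun x hx => hasSum_chebyshev_series hf.continuousOn hsum2 hx) hs
  refine ⟨C, fun s hs x hx N => ?_⟩
  have htail := (hasSum_nat_add_iff' (N + 1)).2 (hser s hs x hx)
  rw [abs_sub_comm]
  refine le_of_tendsto htail.tendsto_sum_nat.abs (Filter.Eventually.of_forall fun n => ?_)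
  refine (Finset.abs_sum_le_sum_abs _ _).trans ?_
  calc _ ≤ ∑ i ∈ Finset.range n, C * (((i + (N + 1) : ℕ) : ℝ) + 1)⁻¹ ^ (ℓ + 2) := by
        refine Finset.sum_le_sum fun i _ => le_trans ?_ (hle _)
        rw [abs_mul]
        gcongr
        refine (abs_eval_iterate_derivative_chebyshev_T_le _ s hx).trans ?_
        gcongr
        push_cast
        linarith [(Nat.cast_nonneg N : (0 : ℝ) ≤ N), (Nat.cast_nonneg i : (0 : ℝ) ≤ i)]
    _ ≤ C / ((N : ℝ) + 1) ^ (ℓ + 1) := by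
        rw [← Finset.mul_sum, div_eq_mul_inv]
        gcongr
        exact sum_range_inv_pow_le N n ℓ

theorem rowSumNorm_mul_le {k : ℕ} (X Y : Matrix (Fin k) (Fin k) ℝ) :
    rowSumNorm (X * Y) ≤ rowSumNorm X * rowSumNorm Y := by
  let _ : SeminormedAddCommGroup (Matrix (Fin k) (Fin k) ℝ) :=
    Matrix.linftyOpSeminormedAddCommGroup
  simpa only [rowSumNorm, ← Matrix.linfty_opNorm_def] using Matrix.linfty_opNorm_mul X Y

theorem rowSumNorm_nonneg {k : ℕ} (X : Matrix (Fin k) (Fin k) ℝ) : 0 ≤ rowSumNorm X :=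
  NNReal.coe_nonneg _

theorem abs_apply_le_rowSumNorm {k : ℕ} (X : Matrix (Fin k) (Fin k) ℝ) (i j : Fin k) :
    |X i j| ≤ rowSumNorm X := by
  have h1 : ‖X i j‖₊ ≤ ∑ j, ‖X i j‖₊ :=
    Finset.single_le_sum (f := fun j => ‖X i j‖₊) (fun _ _ => zero_le) (Finset.mem_univ j)
  have h2 := h1.trans
    (Finset.le_sup (f := fun i => ∑ j, ‖X i j‖₊) (Finset.mem_univ i))
  exact_mod_cast h2

theorem rowSumNorm_le_of_abs_apply_le {k : ℕ} {X : Matrix (Fin k) (Fin k) ℝ} {ε : ℝ}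
    (hε : 0 ≤ ε) (h : ∀ i j, |X i j| ≤ ε) : rowSumNorm X ≤ k * ε := by
  lift ε to ℝ≥0 using hε
  have : (Finset.univ.sup fun i => ∑ j, ‖X i j‖₊) ≤ k * ε := by
    refine Finset.sup_le fun i _ => ?_
    calc ∑ j, ‖X i j‖₊ ≤ ∑ _j : Fin k, ε := Finset.sum_le_sum fun j _ => by exact_mod_cast h i j
      _ = k * ε := by simp
  exact_mod_cast this

theorem AlgebraNorm.exists_le_mul_rowSumNorm {k : ℕ}
    (matNorm : AlgebraNorm ℝ (Matrix (Fin k) (Fin k) ℝ)) :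
    ∃ K, 0 ≤ K ∧ ∀ X, matNorm X ≤ K * rowSumNorm X := by
  refine ⟨∑ i, ∑ j, matNorm (Matrix.single i j 1),
    Finset.sum_nonneg fun i _ => Finset.sum_nonneg fun j _ => apply_nonneg _ _, fun X => ?_⟩
  have hsum {ι : Type} (s : Finset ι) (g : ι → Matrix (Fin k) (Fin k) ℝ) :
      matNorm (∑ i ∈ s, g i) ≤ ∑ i ∈ s, matNorm (g i) :=
    Finset.le_sum_of_subadditive _ (map_zero matNorm).le (map_add_le_add matNorm) _ _
  conv_lhs => rw [Matrix.matrix_eq_sum_single X]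
  rw [Finset.sum_mul]
  refine (hsum _ _).trans (Finset.sum_le_sum fun i _ => ?_)
  rw [Finset.sum_mul]
  refine (hsum _ _).trans (Finset.sum_le_sum fun j _ => ?_)
  have h : Matrix.single i j (X i j) = X i j • Matrix.single i j (1 : ℝ) := by
    simp [Matrix.smul_single]
  rw [h, map_smul_eq_mul, mul_comm]
  exact mul_le_mul_of_nonneg_left (abs_apply_le_rowSumNorm X i j) (apply_nonneg _ _)

section BlockDiag

variable {k p : ℕ} (size : Fin p → ℕ) (h : ∑ i, size i = k)

/-- `blockDiag` as a homomorphism of algebras. -/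
noncomputable def blockDiagAlgHom :
    (∀ i, Matrix (Fin (size i)) (Fin (size i)) ℝ) →ₐ[ℝ] Matrix (Fin k) (Fin k) ℝ :=
  (Matrix.reindexAlgEquiv ℝ ℝ (finSigmaFinEquiv.trans (finCongr h))).toAlgHom.comp
    (AlgHom.ofLinearMap
      { toFun := Matrix.blockDiagonal'
        map_add' := Matrix.blockDiagonal'_add
        map_smul' := Matrix.blockDiagonal'_smul }
      Matrix.blockDiagonal'_one Matrix.blockDiagonal'_mul)

theorem blockDiagAlgHom_apply (M : ∀ i, Matrix (Fin (size i)) (Fin (size i)) ℝ) :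
    blockDiagAlgHom size h M = blockDiag size h M := rfl

theorem blockDiagAlgHom_injective : Function.Injective (blockDiagAlgHom size h) :=
  (Matrix.reindexAlgEquiv ℝ ℝ (finSigmaFinEquiv.trans (finCongr h))).injective.comp
    Matrix.blockDiagonal'_injective

theorem aeval_blockDiag (M : ∀ i, Matrix (Fin (size i)) (Fin (size i)) ℝ) (P : ℝ[X]) :
    aeval (blockDiag size h M) P = blockDiag size h fun i => aeval (M i) P := by
  rw [← blockDiagAlgHom_apply, aeval_algHom_apply, ← blockDiagAlgHom_apply]
  congr 1
  funext i
  exact (aeval_algHom_apply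
    (Pi.evalAlgHom ℝ (fun i => Matrix (Fin (size i)) (Fin (size i)) ℝ) i) M P).symm

theorem abs_blockDiag_apply_le {M : ∀ i, Matrix (Fin (size i)) (Fin (size i)) ℝ} {ε : ℝ}
    (hε : 0 ≤ ε) (hM : ∀ i r s, |M i r s| ≤ ε) (r s : Fin k) :
    |blockDiag size h M r s| ≤ ε := by
  simp only [blockDiag, Matrix.reindex_apply, Matrix.submatrix_apply, Matrix.blockDiagonal'_apply]
  split_ifs
  · exact hM _ _ _
  · simpa

end BlockDiag

theorem aeval_units_conj {A : Type*} [Ring A] [Algebra ℝ A] (u : Aˣ) (b : A) (P : ℝ[X]) :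
    aeval (↑u⁻¹ * b * ↑u : A) P = ↑u⁻¹ * aeval b P * ↑u := by
  induction P using Polynomial.induction_on' with
  | add P Q hP hQ => simp only [map_add, hP, hQ, mul_add, add_mul]
  | monomial n a =>
    simp only [aeval_monomial, Units.conj_pow', ← Algebra.smul_def, mul_smul_comm, smul_mul_assoc]

theorem mul_jordanBlock_apply {n : ℕ} (lam : ℝ) (M : Matrix (Fin n) (Fin n) ℝ) (i j : Fin n) :
    (M * jordanBlock n lam) i j =
      M i j * lam + if hj : 0 < (j : ℕ) then M i ⟨j - 1, by omega⟩ else 0 := by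
  have hsplit (l : Fin n) : M i l * jordanBlock n lam l j =
      (if l = j then M i l * lam else 0) + if (l : ℕ) + 1 = j then M i l else 0 := by
    simp only [jordanBlock, Matrix.of_apply]
    by_cases h : l = j
    · subst h; simp
    · simp [h]
  rw [Matrix.mul_apply, Finset.sum_congr rfl fun l _ => hsplit l, Finset.sum_add_distrib]
  congr 1
  · simp
  · split_ifs with hj
    · rw [Finset.sum_eq_single ⟨(j : ℕ) - 1, by omega⟩]
      · rw [if_pos]
        simp only
        omega
      · intro l _ hl
        rw [if_neg]
        intro h
        apply hl
        ext
        simp only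
        omega
      · simp
    · exact Finset.sum_eq_zero fun l _ => if_neg (by omega)

/-- A polynomial in a Jordan block has the Taylor coefficients on its superdiagonals. -/
theorem aeval_jordanBlock_apply {n : ℕ} (lam : ℝ) (P : ℝ[X]) (i j : Fin n) :
    aeval (jordanBlock n lam) P i j =
      if i ≤ j then (taylor lam P).coeff ((j : ℕ) - (i : ℕ)) else 0 := by
  induction P using Polynomial.induction_on generalizing i j with
  | C a =>
    simp only [aeval_C, Matrix.algebraMap_matrix_apply, taylor_C, coeff_C, Algebra.algebraMap_self,
      RingHom.id_apply]
    by_cases h : i = j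
    · simp [h]
    · rw [if_neg h]
      split_ifs with h1 h2
      · exact absurd (Fin.ext (by have : (i : ℕ) ≤ j := h1; omega)) h
      · rfl
      · rfl
  | add P Q hP hQ =>
    rw [map_add, Matrix.add_apply, hP, hQ, map_add, coeff_add]
    split_ifs <;> simp
  | monomial n a ih =>
    rw [pow_succ, ← mul_assoc, map_mul, aeval_X, mul_jordanBlock_apply, ih, taylor_mul lam (C a * X ^ n) X,
      taylor_X, mul_add, coeff_add, coeff_mul_C]
    simp only [ih]
    by_cases hij : i ≤ j
    · have hij' : (i : ℕ) ≤ j := hij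
      rw [if_pos hij, if_pos hij, add_comm]
      congr 1
      rcases hij'.eq_or_lt with h | h
      · rw [h, Nat.sub_self, coeff_mul_X_zero]
        split_ifs with h1 h2
        · have : (i : ℕ) ≤ j - 1 := h2
          omega
        · rfl
        · rfl
      · rw [dif_pos (by omega), if_pos (by change (i : ℕ) ≤ j - 1; omega),
          show (j : ℕ) - i = (j - 1 - i) + 1 by omega, coeff_mul_X]
    · have hij' : ¬ (i : ℕ) ≤ j := hij
      rw [if_neg hij, if_neg hij]
      split_ifs with h1 h2
      · have : (i : ℕ) ≤ j - 1 := h2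
        omega
      · simp
      · simp

theorem taylor_coeff_eq_iterate_derivative (P : ℝ[X]) (x : ℝ) (d : ℕ) :
    (taylor x P).coeff d = (derivative^[d] P).eval x / (d ! : ℝ) := by
  rw [taylor_coeff, ← factorial_smul_hasseDeriv, eq_div_iff (by positivity)]
  simp [mul_comm]

namespace JordanForm

variable {k : ℕ} {A : Matrix (Fin k) (Fin k) ℝ} (D : JordanForm A)

theorem aeval_eq (P : ℝ[X]) :
    aeval A P = (↑D.Z⁻¹ : Matrix (Fin k) (Fin k) ℝ) *
      blockDiag D.size D.sum_size
        (fun i => aeval (jordanBlock (D.size i) (D.eigenvalue i)) P) *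
      (↑D.Z : Matrix (Fin k) (Fin k) ℝ) := by
  conv_lhs => rw [D.eq_conj]
  rw [aeval_units_conj, aeval_blockDiag]

theorem eigenvalue_mem_spectrum (i : Fin D.numBlocks) : D.eigenvalue i ∈ spectrum ℝ A := by
  have hconj := congrArg (spectrum ℝ) D.eq_conj
  rw [spectrum.units_conjugate'] at hconj
  rw [hconj, spectrum.mem_iff, ← blockDiagAlgHom_apply,
    ← (blockDiagAlgHom D.size D.sum_size).commutes, ← map_sub]
  intro hu
  let z : Fin (D.size i) := ⟨0, D.size_pos i⟩
  let E : ∀ i, Matrix (Fin (D.size i)) (Fin (D.size i)) ℝ :=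
    Pi.single i (Matrix.single z z (1 : ℝ))
  have hz : (algebraMap ℝ _ (D.eigenvalue i) -
      fun i => jordanBlock (D.size i) (D.eigenvalue i)) * E = 0 := by
    funext j
    rcases eq_or_ne j i with rfl | hj
    · ext r s
      simp only [E, Pi.mul_apply, Pi.single_eq_same, Pi.zero_apply, Matrix.zero_apply]
      by_cases hs : s = z
      · subst hs
        rw [Matrix.mul_single_apply_same]
        simp only [Pi.sub_apply, Pi.algebraMap_apply, Matrix.sub_apply,
          Matrix.algebraMap_matrix_apply, jordanBlock, Matrix.of_apply, z]
        by_cases hr : r = ⟨0, D.size_pos j⟩ <;> simp [hr]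
      · rw [Matrix.mul_single_apply_of_ne _ _ _ _ _ hs]
    · simp [E, hj]
  have h0 := congrArg (blockDiagAlgHom D.size D.sum_size) hz
  rw [map_mul, map_zero, hu.mul_right_eq_zero, map_eq_zero_iff _ (blockDiagAlgHom_injective _ _)]
    at h0
  have h1 := congrFun (congrFun (congrFun h0 i) z) z
  simp [E] at h1

theorem eigenvalue_mem_Icc (hA : spectralRadius ℝ A ≤ 1) (i : Fin D.numBlocks) :
    D.eigenvalue i ∈ Icc (-1 : ℝ) 1 := by
  have h : (‖D.eigenvalue i‖₊ : ENNReal) ≤ 1 :=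
    (le_iSup₂ (f := fun x (_ : x ∈ spectrum ℝ A) => (‖x‖₊ : ENNReal)) _
      (D.eigenvalue_mem_spectrum i)).trans hA
  rw [mem_Icc, ← abs_le, ← Real.norm_eq_abs]
  exact_mod_cast h

theorem size_le_maxBlockSize (i : Fin D.numBlocks) : D.size i ≤ D.maxBlockSize :=
  Finset.le_sup (Finset.mem_univ i)

/-- If a polynomial and its derivatives of order less than the largest block size are within `ε`
of those of `f` at the eigenvalues, then its value at `A` is within a multiple of `ε` of `f(A)`. -/
theorem rowSumNorm_aeval_sub_matrixFunction_le {f : ℝ → ℝ} {P : ℝ[X]} {ε : ℝ} (hε : 0 ≤ ε)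
    (h : ∀ i, ∀ s < D.maxBlockSize, |(derivative^[s] P).eval (D.eigenvalue i) -
      iteratedDerivWithin s f (Icc (-1) 1) (D.eigenvalue i)| ≤ ε) :
    rowSumNorm (aeval A P - D.matrixFunction f) ≤ k * ε * D.condNumber := by
  rw [D.aeval_eq, matrixFunction, ← sub_mul, ← mul_sub, ← blockDiagAlgHom_apply,
    ← blockDiagAlgHom_apply, ← map_sub, blockDiagAlgHom_apply]
  set E := blockDiag D.size D.sum_size _
  have hE : rowSumNorm E ≤ k * ε := by
    refine rowSumNorm_le_of_abs_apply_le hε (abs_blockDiag_apply_le _ _ hε fun i r s => ?_)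
    simp only [Pi.sub_apply, Matrix.sub_apply, aeval_jordanBlock_apply, jordanBlockFun,
      Matrix.of_apply]
    split_ifs with hrs
    · rw [taylor_coeff_eq_iterate_derivative, ← sub_div, abs_div, Nat.abs_cast]
      have hfac : (1 : ℝ) ≤ (((s : ℕ) - (r : ℕ))! : ℝ) := by
        exact_mod_cast Nat.succ_le_of_lt (Nat.factorial_pos _)
      refine (div_le_self (abs_nonneg _) hfac).trans (h i _ ?_)
      exact (Nat.sub_le _ _).trans_lt (s.2.trans_le (D.size_le_maxBlockSize i))
    · simpa using hε
  calc _ ≤ rowSumNorm (↑D.Z⁻¹ : Matrix (Fin k) (Fin k) ℝ) * rowSumNorm E *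
        rowSumNorm (↑D.Z : Matrix (Fin k) (Fin k) ℝ) :=
      (rowSumNorm_mul_le _ _).trans (mul_le_mul_of_nonneg_right (rowSumNorm_mul_le _ _)
        (rowSumNorm_nonneg _))
    _ ≤ rowSumNorm (↑D.Z⁻¹ : Matrix (Fin k) (Fin k) ℝ) * (k * ε) *
        rowSumNorm (↑D.Z : Matrix (Fin k) (Fin k) ℝ) := by
      gcongr <;> exact rowSumNorm_nonneg _
    _ = _ := by rw [condNumber]; ring

end JordanForm

theorem mainTheorem4 (k m ℓ : ℕ) (hm : 1 ≤ m)
    (matNorm : AlgebraNorm ℝ (Matrix (Fin k) (Fin k) ℝ)) (f : ℝ → ℝ)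
    (hf : ContDiffOn ℝ ((2 * m - 2 + ℓ : ℕ) : WithTop ℕ∞) f (Icc (-1) 1))
    (hac : AbsolutelyContinuousOnInterval
      (iteratedDerivWithin (2 * m - 2 + ℓ) f (Icc (-1) 1)) (-1) 1)
    (hbv : HasBoundedVariationDeriv (iteratedDerivWithin (2 * m - 2 + ℓ) f (Icc (-1) 1))) :
    ∃ K : ℝ, ∀ A : Matrix (Fin k) (Fin k) ℝ, spectralRadius ℝ A ≤ 1 →
      ∀ D : JordanForm A, D.maxBlockSize = m →
        ∀ N : ℕ, 2 * m - 1 + ℓ < N →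
          matNorm (chebyshevPartialSum f N A - D.matrixFunction f) ≤
            K * D.condNumber / ((N : ℝ) - (2 * (m : ℝ) - 1 + (ℓ : ℝ))) ^ (ℓ + 1) := by
  obtain ⟨M, rfl⟩ : ∃ M, m = M + 1 := ⟨m - 1, by omega⟩
  rw [show 2 * (M + 1) - 2 + ℓ = 2 * M + ℓ by omega] at hf hac hbv
  obtain ⟨C, hC⟩ := exists_abs_chebyshev_sub_iteratedDerivWithin_le hf hac hbv
  obtain ⟨K, hK0, hK⟩ := matNorm.exists_le_mul_rowSumNorm
  have hC0 : 0 ≤ C := by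
    simpa using (abs_nonneg _).trans (hC 0 (Nat.zero_le M) 0 (by norm_num) 0)
  refine ⟨K * (k * C), fun A hA D hD N hN => ?_⟩
  set P : ℝ[X] := ∑ n ∈ Finset.range (N + 1),
    ((if n = 0 then 1 / 2 else 1) * chebyshevCoeff f n) • Polynomial.Chebyshev.T ℝ (n : ℤ) with hP
  have hPA : chebyshevPartialSum f N A = aeval A P := by
    simp only [chebyshevPartialSum, hP, map_sum, map_smul]
  have hderiv (s : ℕ) (x : ℝ) : (derivative^[s] P).eval x =
      ∑ n ∈ Finset.range (N + 1), ((if n = 0 then 1 / 2 else 1) * chebyshevCoeff f n) *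
        (derivative^[s] (Polynomial.Chebyshev.T ℝ (n : ℤ))).eval x := by
    simp only [hP, iterate_derivative_sum, iterate_derivative_smul, eval_finsetSum, eval_smul,
      smul_eq_mul]
  have hbound := D.rowSumNorm_aeval_sub_matrixFunction_le (f := f) (P := P)
    (ε := C / ((N : ℝ) + 1) ^ (ℓ + 1)) (by positivity) fun i s hs => by
      rw [hderiv]
      exact hC s (by omega) _ (D.eigenvalue_mem_Icc hA i) N
  have hcond : 0 ≤ D.condNumber := mul_nonneg (rowSumNorm_nonneg _) (rowSumNorm_nonneg _)
  have hN' : 2 * (M : ℝ) + 1 + ℓ < N := by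
    have : 2 * M + 1 + ℓ < N := by omega
    exact_mod_cast this
  rw [hPA]
  calc _ ≤ K * (k * (C / ((N : ℝ) + 1) ^ (ℓ + 1)) * D.condNumber) :=
        (hK _).trans (mul_le_mul_of_nonneg_left hbound hK0)
    _ = K * (k * C) * D.condNumber / ((N : ℝ) + 1) ^ (ℓ + 1) := by ring
    _ ≤ _ := by
      have hM : (0 : ℝ) ≤ M := Nat.cast_nonneg M
      have hℓ : (0 : ℝ) ≤ ℓ := Nat.cast_nonneg ℓ
      push_cast
      gcongr
      · exact pow_pos (by linarith) _
      · linarith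
      · linarith
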